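/- Let $\mathcal C$ be a skeletally small preadditive category and let $\mathrm{Mod}(\mathcal C)$ be the category of additive covariant functors $\mathcal C\to\mathbf{Ab}$. A left ideal of $\mathrm{Hom}_{\mathcal C}(C,-)$ is an additive subfunctor $I$ of it; for $h:C\to B$, let $(I:h)$ be the left ideal of $\mathrm{Hom}_{\mathcal C}(B,-)$ with $(I:h)(C')=\{f:B\to C'\mid f\circ h\in I(C')\}$. A left Gabriel filter $\mathcal F=\{\mathcal F_C\}_{C\in\mathcal C}$ consists of non-empty sets $\mathcal F_C$ of left ideals of $\mathrm{Hom}_{\mathcal C}(C,-)$ such that: * ($T_1$) if $I\in\mathcal F_C$ and $I\subseteq J$, then $J\in\mathcal F_C$; * ($T_2$) if $I,J\in\mathcal F_C$, then $I\cap J\in\mathcal F_C$; * ($T_3$) if $I\in\mathcal F_C$ and $h:C\to B$, then $(I:h)\in\mathcal F_B$; * ($T_4$) if $J\in\mathcal F_C$ and $I$ is a left ideal of $\mathrm{Hom}_{\mathcal C}(C,-)$ such that $(I:h)\in\mathcal F_B$ for all $B\in\mathcal C$ and all $h\in J(B)$, then $I\in\mathcal F_C$. Let $\mathcal F$ be a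 left Gabriel filter. Let $\mathcal T_{\mathcal F}$ be the class of modules $M$ such that, for all $C\in\mathcal C$ and $x\in M(C)$, the annihilator $\mathrm{Ann}(x,-)=\{f\mid M(f)(x)=0\}\subseteq\mathrm{Hom}_{\mathcal C}(C,-)$ belongs to $\mathcal F_C$; it is a Serre class. Let $i:\mathrm{Mod}(\mathcal C,\mathcal F)\to\mathrm{Mod}(\mathcal C)$ be the inclusion of the full subcategory of $\mathcal F$-closed modules, that is, of the modules $M$ such that the restriction map $\mathrm{Hom}(\mathrm{Hom}_{\mathcal C}(C,-),M)\to\mathrm{Hom}(I,M)$ is bijective for all $C\in\mathcal C$ and $I\in\mathcal F_C$. Let $Q:\mathrm{Mod}(\mathcal C)\to\mathrm{Mod}(\mathcal C)/\mathcal T_{\mathcal F}$ be the Gabriel quotient, that is, the localization of $\mathrm{Mod}(\mathcal C)$ at the morphisms whose kernel and cokernel lie in $\mathcal T_{\mathcal F}$. Then there is an equivalence of categories $$e:\mathrm{Mod}(\mathcal C,\mathcal F)\;\simeq\;\mathrm{Mod}(\mathcal C)/\mathcal T_{\mathcal F}.$$ More precisely, $i$ has an exact left adjoint $\mathbb G:\mathrm{Mod}(\mathcal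 C)\to\mathrm{Mod}(\mathcal C,\mathcal F)$ with $\mathbb G(M)=0$ if and only if $M\in\mathcal T_{\mathcal F}$, and $e$ can be chosen such that $e\cong Q\circ i$ and $e\circ\mathbb G\cong Q$. -/

import Mathlib

open CategoryTheory CategoryTheory.Limits

universe v u

namespace GabrielLocalization

section Modules

variable (C : Type u) [Category.{v} C] [Preadditive C]

/-- The category `Mod(C)` of (left) `C`-modules: covariant additive functors from the preadditive
category `C` to the category of abelian groups, with all natural transformations as morphisms. -/
abbrev ModCat : Type _ := C ⥤+ AddCommGrpCat.{v}

/-! Additive functors are closed under kernels, cokernels and finite products in the category of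
all functors, so that `Mod(C)` is an abelian category. -/

theorem additive_of_isLimit {J : Type*} [Category J] {K : J ⥤ C ⥤ AddCommGrpCat.{v}}
    (c : Cone K) (h : ∀ Y : C, IsLimit (((evaluation C AddCommGrpCat.{v}).obj Y).mapCone c))
    (hK : ∀ j, (K.obj j).Additive) : c.pt.Additive where
  map_add {X Y f g} := by
    refine (h Y).hom_ext fun j => ?_
    have := hK j
    change c.pt.map (f + g) ≫ (c.π.app j).app Y = (c.pt.map f + c.pt.map g) ≫ (c.π.app j).app Y
    rw [Preadditive.add_comp, NatTrans.naturality, NatTrans.naturality, NatTrans.naturality]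
    rw [Functor.map_add, Preadditive.comp_add]

theorem additive_of_isColimit {J : Type*} [Category J] {K : J ⥤ C ⥤ AddCommGrpCat.{v}}
    (c : Cocone K) (h : ∀ Y : C, IsColimit (((evaluation C AddCommGrpCat.{v}).obj Y).mapCocone c))
    (hK : ∀ j, (K.obj j).Additive) : c.pt.Additive where
  map_add {X Y f g} := by
    refine (h X).hom_ext fun j => ?_
    have := hK j
    change (c.ι.app j).app X ≫ c.pt.map (f + g) = (c.ι.app j).app X ≫ (c.pt.map f + c.pt.map g)
    have hn : ∀ k : X ⟶ Y, (c.ι.app j).app X ≫ c.pt.map k =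
        (K.obj j).map k ≫ (c.ι.app j).app Y := fun k => ((c.ι.app j).naturality k).symm
    rw [Preadditive.comp_add, hn, hn, hn, Functor.map_add, Preadditive.add_comp]

instance additive_isClosedUnderIsomorphisms :
    (additiveFunctor C AddCommGrpCat.{v}).IsClosedUnderIsomorphisms where
  of_iso e h := by
    rw [additiveFunctor_iff] at h ⊢
    exact Functor.additive_of_iso e

instance additive_containsZero : (additiveFunctor C AddCommGrpCat.{v}).ContainsZero where
  exists_zero := by
    obtain ⟨Z, hZ⟩ := HasZeroObject.zero (C := C ⥤ AddCommGrpCat.{v})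
    exact ⟨Z, hZ, Functor.Additive.of_isZero hZ⟩

instance additive_isClosedUnderKernels :
    (additiveFunctor C AddCommGrpCat.{v}).IsClosedUnderKernels where
  kernels_le := by
    rintro _ ⟨f, k, hk, hX, hY⟩
    refine additive_of_isLimit C k
      (fun Y => isLimitOfPreserves ((evaluation C AddCommGrpCat.{v}).obj Y) hk) ?_
    rintro (_ | _)
    · exact hX
    · exact hY

instance additive_isClosedUnderCokernels :
    (additiveFunctor C AddCommGrpCat.{v}).IsClosedUnderCokernels where
  cokernels_le := by
    rintro _ ⟨f, k, hk, hX, hY⟩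
    refine additive_of_isColimit C k
      (fun Y => isColimitOfPreserves ((evaluation C AddCommGrpCat.{v}).obj Y) hk) ?_
    rintro (_ | _)
    · exact hX
    · exact hY

instance additive_isClosedUnderFiniteProducts :
    (additiveFunctor C AddCommGrpCat.{v}).IsClosedUnderFiniteProducts where
  isClosedUnderLimitsOfShape J _ :=
    { limitsOfShape_le := by
        rintro _ ⟨p⟩
        exact additive_of_isLimit C _
          (fun Y => isLimitOfPreserves ((evaluation C AddCommGrpCat.{v}).obj Y) p.isLimit)
          p.prop_diag_obj }

noncomputable instance modCatAbelian : Abelian (ModCat C) :=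
  inferInstanceAs (Abelian (additiveFunctor C AddCommGrpCat.{v}).FullSubcategory)

end Modules

section Ideals

variable {C : Type u} [Category.{v} C] [Preadditive C]

/-- A left ideal of `Hom(X, -)`, that is, an additive subfunctor of `Hom(X, -)`: a subgroup of each
`Hom(X, Y)`, stable under composition with morphisms `Y ⟶ Z`. -/
@[ext]
structure LeftIdeal (X : C) where
  carrier : ∀ Y : C, AddSubgroup (X ⟶ Y)
  comp_mem : ∀ {Y Z : C} {f : X ⟶ Y} (g : Y ⟶ Z), f ∈ carrier Y → f ≫ g ∈ carrier Z

namespace LeftIdeal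

variable {X : C}

/-- Inclusion of left ideals. -/
instance : LE (LeftIdeal X) where
  le I J := ∀ (Y : C) (f : X ⟶ Y), f ∈ I.carrier Y → f ∈ J.carrier Y

/-- The intersection of two left ideals. -/
def inter (I J : LeftIdeal X) : LeftIdeal X where
  carrier Y := I.carrier Y ⊓ J.carrier Y
  comp_mem g hf := ⟨I.comp_mem g hf.1, J.comp_mem g hf.2⟩

/-- The left ideal `(I : h)` of `Hom(B, -)`, for a left ideal `I` of `Hom(X, -)` and
`h : X ⟶ B`; it consists of the `f : B ⟶ Y` with `f ∘ h ∈ I`. -/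
def colon (I : LeftIdeal X) {B : C} (h : X ⟶ B) : LeftIdeal B where
  carrier Y :=
    { carrier := {f | h ≫ f ∈ I.carrier Y}
      add_mem' := fun {a b} ha hb => by
        simpa only [Set.mem_ofPred_eq, Preadditive.comp_add] using (I.carrier Y).add_mem ha hb
      zero_mem' := by simp
      neg_mem' := fun {a} ha => by
        simpa only [Set.mem_ofPred_eq, Preadditive.comp_neg] using (I.carrier Y).neg_mem ha }
  comp_mem {Y Z f} g hf := by
    change h ≫ f ≫ g ∈ I.carrier Z
    rw [← Category.assoc]
    exact I.comp_mem g hf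

/-- The annihilator `Ann(x, -)` of an element `x ∈ M(X)` of a module `M`: it consists of the
`f : X ⟶ Y` with `M(f)(x) = 0`. -/
def ann (M : ModCat C) (x : M.obj.obj X) : LeftIdeal X where
  carrier Y :=
    { carrier := {f | (M.obj.map f).hom x = 0}
      add_mem' := fun {a b} ha hb => by
        simp only [Set.mem_ofPred_eq] at ha hb ⊢
        simp [ha, hb]
      zero_mem' := by simp
      neg_mem' := fun {a} ha => by
        simp only [Set.mem_ofPred_eq] at ha ⊢
        simp [ha] }
  comp_mem {Y Z f} g hf := by
    change (M.obj.map (f ≫ g)).hom x = 0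
    have hf' : (M.obj.map f).hom x = 0 := hf
    rw [Functor.map_comp, AddCommGrpCat.hom_comp, AddMonoidHom.comp_apply, hf', map_zero]

/-- A left ideal, as a module. -/
def toMod (I : LeftIdeal X) : ModCat C where
  obj :=
    { obj := fun Y => AddCommGrpCat.of (I.carrier Y)
      map := fun {Y Z} g => AddCommGrpCat.ofHom
        { toFun := fun f => ⟨f.1 ≫ g, I.comp_mem g f.2⟩
          map_zero' := by ext; simp
          map_add' := fun a b => by ext; simp }
      map_id := fun Y => by ext; simp
      map_comp := fun f g => by ext; simp }
  property :=
    { map_add := fun {Y Z f g} => by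
        apply AddCommGrpCat.hom_ext
        ext x
        exact Preadditive.comp_add _ _ _ _ _ _ }

end LeftIdeal

/-- The representable module `Hom(X, -)`. -/
noncomputable def rep (X : C) : ModCat C :=
  AdditiveFunctor.of (preadditiveCoyoneda.obj (Opposite.op X))

/-- The inclusion `δ_I` of a left ideal `I` into `Hom(X, -)`. -/
noncomputable def LeftIdeal.incl {X : C} (I : LeftIdeal X) : I.toMod ⟶ rep X :=
  ObjectProperty.homMk
    { app := fun Y => AddCommGrpCat.ofHom (I.carrier Y).subtype
      naturality := fun _ _ _ => rfl }

end Ideals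

variable (C : Type u) [Category.{v} C] [Preadditive C] in
/-- A left Gabriel filter of the preadditive category `C`: a family of filters of left ideals of
the functors `Hom(X, -)`, with the properties T1 to T4. -/
structure LeftGabrielFilter where
  /-- The left ideals of `Hom(X, -)` that belong to the filter. -/
  sets : ∀ X : C, Set (LeftIdeal X)
  nonempty : ∀ X : C, (sets X).Nonempty
  mem_of_le : ∀ {X : C} {I J : LeftIdeal X}, I ∈ sets X → I ≤ J → J ∈ sets X
  inter_mem : ∀ {X : C} {I J : LeftIdeal X}, I ∈ sets X → J ∈ sets X → I.inter J ∈ sets X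
  colon_mem : ∀ {X B : C} {I : LeftIdeal X} (h : X ⟶ B), I ∈ sets X → I.colon h ∈ sets B
  mem_of_colon_mem : ∀ {X : C} {I J : LeftIdeal X}, J ∈ sets X →
    (∀ (B : C) (h : X ⟶ B), h ∈ J.carrier B → I.colon h ∈ sets B) → I ∈ sets X

namespace LeftGabrielFilter

variable {C : Type u} [Category.{v} C] [Preadditive C] (F : LeftGabrielFilter C)

/-- The class `T_F` of `F`-torsion modules: all annihilators of elements belong to `F`. -/
def torsion : ObjectProperty (ModCat C) :=
  fun M => ∀ (X : C) (x : M.obj.obj X), LeftIdeal.ann M x ∈ F.sets X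

/-- A module `M` is `F`-closed if, for each `I` in the filter, restriction along the inclusion
`δ_I` is a bijection `Hom(Hom(X, -), M) → Hom(I, M)`. -/
def closed : ObjectProperty (ModCat C) :=
  fun M => ∀ (X : C) (I : LeftIdeal X), I ∈ F.sets X →
    Function.Bijective (fun g : rep X ⟶ M => I.incl ≫ g)

/-- The full subcategory `Mod(C, F)` of `Mod(C)` that consists of the `F`-closed modules. -/
abbrev ClosedModCat : Type _ := F.closed.FullSubcategory

/-- The inclusion functor `Mod(C, F) ⥤ Mod(C)`. -/
abbrev inclusion : F.ClosedModCat ⥤ ModCat C := F.closed.ι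

end LeftGabrielFilter

/-! The torsion class of a Gabriel filter is a Serre class. -/

section Serre

variable {C : Type u} [Category.{v} C] [Preadditive C]

/-- Evaluation of modules at an object. -/
abbrev evalAt (X : C) : ModCat C ⥤ AddCommGrpCat.{v} :=
  AdditiveFunctor.forget C AddCommGrpCat.{v} ⋙ (evaluation C AddCommGrpCat.{v}).obj X

theorem app_injective_of_mono {M N : ModCat C} (f : M ⟶ N) [Mono f] (X : C) :
    Function.Injective (f.hom.app X).hom := by
  have := (additiveFunctor C AddCommGrpCat.{v}).preservesMonomorphisms_ι_of_isNormalEpiCategory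
  have : Mono ((evalAt X).map f) := inferInstance
  exact (AddCommGrpCat.mono_iff_injective _).1 this

theorem app_surjective_of_epi {M N : ModCat C} (f : M ⟶ N) [Epi f] (X : C) :
    Function.Surjective (f.hom.app X).hom := by
  have := (additiveFunctor C AddCommGrpCat.{v}).preservesEpimorphisms_ι_of_isNormalMonoCategory
  have : Epi ((evalAt X).map f) := inferInstance
  exact (AddCommGrpCat.epi_iff_surjective _).1 this

theorem exists_of_shortExact {S : ShortComplex (ModCat C)} (hS : S.ShortExact) (X : C)
    (x : S.X₂.obj.obj X) (hx : (S.g.hom.app X).hom x = 0) :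
    ∃ y : S.X₁.obj.obj X, (S.f.hom.app X).hom y = x := by
  have : (AdditiveFunctor.forget C AddCommGrpCat.{v}).PreservesHomology :=
    { preservesKernels := fun _ _ f =>
        (additiveFunctor C AddCommGrpCat.{v}).preservesKernels_ι f
      preservesCokernels := fun _ _ f =>
        (additiveFunctor C AddCommGrpCat.{v}).preservesCokernels_ι f }
  have h1 := (hS.exact.map (AdditiveFunctor.forget C AddCommGrpCat.{v})).map
    ((evaluation C AddCommGrpCat.{v}).obj X)
  exact (ShortComplex.ab_exact_iff _).1 h1 x hx

theorem naturality_apply {M N : ModCat C} (f : M ⟶ N) {X Y : C} (g : X ⟶ Y) (x : M.obj.obj X) :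
    (f.hom.app Y).hom ((M.obj.map g).hom x) = (N.obj.map g).hom ((f.hom.app X).hom x) := by
  have h := congrArg (fun k => k.hom x) (f.hom.naturality g)
  exact h

theorem ann_le_ann_app {M N : ModCat C} (f : M ⟶ N) {X : C} (x : M.obj.obj X) :
    LeftIdeal.ann M x ≤ LeftIdeal.ann N ((f.hom.app X).hom x) := by
  intro Y g hg
  have hg' : (M.obj.map g).hom x = 0 := hg
  change (N.obj.map g).hom _ = 0
  rw [← naturality_apply, hg', map_zero]

theorem ann_app_le_ann {M N : ModCat C} (f : M ⟶ N) [Mono f] {X : C} (x : M.obj.obj X) :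
    LeftIdeal.ann N ((f.hom.app X).hom x) ≤ LeftIdeal.ann M x := by
  intro Y g hg
  have hg' : (N.obj.map g).hom ((f.hom.app X).hom x) = 0 := hg
  rw [← naturality_apply] at hg'
  exact app_injective_of_mono f Y (hg'.trans (map_zero _).symm)

instance torsion_isSerreClass (F : LeftGabrielFilter C) : F.torsion.IsSerreClass where
  exists_zero := by
    obtain ⟨Z, hZ⟩ := HasZeroObject.zero (C := ModCat C)
    refine ⟨Z, hZ, fun X x => ?_⟩
    obtain ⟨I, hI⟩ := F.nonempty X
    refine F.mem_of_le hI fun Y f _ => ?_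
    have h0 : IsZero ((evalAt Y).obj Z) := (evalAt Y).map_isZero hZ
    have := AddCommGrpCat.subsingleton_of_isZero h0
    exact this.elim _ _
  prop_of_mono f _ hY X x := F.mem_of_le (hY X _) (ann_app_le_ann f x)
  prop_of_epi f _ hM X x := by
    obtain ⟨y, rfl⟩ := app_surjective_of_epi f X x
    exact F.mem_of_le (hM X y) (ann_le_ann_app f y)
  prop_X₂_of_shortExact {S} hS h₁ h₃ X x := by
    refine F.mem_of_colon_mem (h₃ X ((S.g.hom.app X).hom x)) fun B h hh => ?_
    have hz : (S.g.hom.app B).hom ((S.X₂.obj.map h).hom x) = 0 :=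
      (naturality_apply S.g h x).trans hh
    obtain ⟨y, hy⟩ := exists_of_shortExact hS B _ hz
    refine F.mem_of_le (h₁ B y) fun Y f hf => ?_
    have hf' := ann_le_ann_app S.f y Y f hf
    rw [hy] at hf'
    change (S.X₂.obj.map (h ≫ f)).hom x = 0
    rw [Functor.map_comp, AddCommGrpCat.hom_comp, AddMonoidHom.comp_apply]
    exact hf'

end Serre

namespace LeftGabrielFilter

variable {C : Type u} [Category.{v} C] [Preadditive C] (F : LeftGabrielFilter C)

/-- The Gabriel quotient `Mod(C)/T_F`: the localization of `Mod(C)` at the class of morphisms with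
kernel and cokernel in the Serre class `T_F`. -/
abbrev GabrielQuotient : Type _ := F.torsion.isoModSerre.Localization

/-- The quotient functor `Mod(C) ⥤ Mod(C)/T_F`. -/
abbrev quotientFunctor : ModCat C ⥤ F.GabrielQuotient := F.torsion.isoModSerre.Q

end LeftGabrielFilter

end GabrielLocalization

/-! Call a morphism a weak equivalence if its kernel and cokernel are torsion. Two facts carry the
proof. (a) Closed modules are local: every morphism `A ⟶ N` with `N` closed extends uniquely along a
weak equivalence `A ⟶ B` (`isoModSerre_le_isLocal_closed`). The extension at `b` solves a Hom(I,
N)-problem, where `I` consists of the `h` that carry `b` into the image of `A`. (b) Every module has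
a weak equivalence to a closed one (`exists_isoModSerre_closed`), namely `M ⟶ M⁺ ⟶ M⁺⁺` with `M⁺(X)
= colim Hom(I, M)` over the filter. One step makes the module torsion-free, and a second makes it
closed. By (a) and (b) the closed modules are reflective with weak equivalences as units. By
two-out-of-three the reflector `G` inverts exactly the weak equivalences, so `G` is a localization
at them, as `Q` is. Uniqueness of localizations gives `e`; exactness and the kernel of `G` are read
off from `Q`. Essential smallness of `C` enters in `M⁺`: families indexed by representatives of
objects stay in universe `v`. -/

namespace GabrielLocalization

variable {C : Type u} [Category.{v} C] [Preadditive C]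

/-! ### Elements of modules, kernels and cokernels -/

section Elements

theorem map_comp_apply (M : ModCat C) {X Y Z : C} (f : X ⟶ Y) (g : Y ⟶ Z) (x : M.obj.obj X) :
    (M.obj.map (f ≫ g)).hom x = (M.obj.map g).hom ((M.obj.map f).hom x) := by
  rw [Functor.map_comp, AddCommGrpCat.hom_comp, AddMonoidHom.comp_apply]

theorem map_id_apply (M : ModCat C) {X : C} (x : M.obj.obj X) :
    (M.obj.map (𝟙 X)).hom x = x := by
  rw [M.obj.map_id, AddCommGrpCat.hom_id, AddMonoidHom.id_apply]

theorem map_add_apply (M : ModCat C) {X Y : C} (f g : X ⟶ Y) (x : M.obj.obj X) :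
    (M.obj.map (f + g)).hom x = (M.obj.map f).hom x + (M.obj.map g).hom x := by
  rw [Functor.map_add, AddCommGrpCat.hom_add, AddMonoidHom.add_apply]

theorem hom_ext_apply {M N : ModCat C} {f g : M ⟶ N}
    (h : ∀ (X : C) (x : M.obj.obj X), (f.hom.app X).hom x = (g.hom.app X).hom x) : f = g := by
  apply ObjectProperty.hom_ext
  ext X x
  exact h X x

theorem comp_apply {M N P : ModCat C} (f : M ⟶ N) (g : N ⟶ P) {X : C} (x : M.obj.obj X) :
    ((f ≫ g).hom.app X).hom x = (g.hom.app X).hom ((f.hom.app X).hom x) := rfl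

/-- A morphism of modules from its components. -/
def homOfComponents {M N : ModCat C} (φ : ∀ X : C, M.obj.obj X → N.obj.obj X)
    (hadd : ∀ (X : C) (x y : M.obj.obj X), φ X (x + y) = φ X x + φ X y)
    (hmap : ∀ (X Y : C) (f : X ⟶ Y) (x : M.obj.obj X),
      φ Y ((M.obj.map f).hom x) = (N.obj.map f).hom (φ X x)) : M ⟶ N :=
  ObjectProperty.homMk
    { app := fun X => AddCommGrpCat.ofHom (AddMonoidHom.mk' (φ X) (hadd X))
      naturality := fun X Y f => by
        ext x
        exact hmap X Y f x }

/-- The morphism `Hom(X, -) ⟶ M` that corresponds to an element of `M(X)`. -/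
noncomputable def ofElement (M : ModCat C) {X : C} (x : M.obj.obj X) : rep X ⟶ M :=
  homOfComponents (M := rep X) (fun _ f => (M.obj.map f).hom x)
    (fun _ f g => map_add_apply M f g x) (fun _ _ g f => map_comp_apply M f g x)

theorem rep_hom_apply {M : ModCat C} {X Y : C} (g : rep X ⟶ M) (f : X ⟶ Y) :
    (g.hom.app Y).hom f =
      (M.obj.map f).hom ((g.hom.app X).hom (show (rep X).obj.obj X from 𝟙 X)) := by
  rw [← naturality_apply]
  congr 1
  exact (Category.id_comp f).symm

/-- The left ideal of all `h : X ⟶ Y` such that `N(h)(y)` is in the image of a morphism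
`M ⟶ N`. -/
def rangeIdeal {M N : ModCat C} (f : M ⟶ N) {X : C} (y : N.obj.obj X) : LeftIdeal X where
  carrier Y := (f.hom.app Y).hom.range.comap
    { toFun := fun h => (N.obj.map h).hom y
      map_zero' := by simp
      map_add' := fun g h => map_add_apply N g h y }
  comp_mem {Y Z h} g hh := by
    obtain ⟨x, hx⟩ := hh
    refine ⟨(M.obj.map g).hom x, ?_⟩
    rw [naturality_apply, hx]
    exact (map_comp_apply N h g y).symm

theorem mem_rangeIdeal {M N : ModCat C} {f : M ⟶ N} {X Y : C} {y : N.obj.obj X} {h : X ⟶ Y} :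
    h ∈ (rangeIdeal f y).carrier Y ↔ ∃ x, (f.hom.app Y).hom x = (N.obj.map h).hom y := Iff.rfl

theorem mem_ann {M : ModCat C} {X Y : C} {x : M.obj.obj X} {h : X ⟶ Y} :
    h ∈ (LeftIdeal.ann M x).carrier Y ↔ (M.obj.map h).hom x = 0 := Iff.rfl

/-- The left ideal of the elements of `I` that a morphism `I ⟶ N` maps to the image of
`M ⟶ N`. -/
def LeftIdeal.comapRange {M N : ModCat C} (f : M ⟶ N) {X : C} {I : LeftIdeal X}
    (g : I.toMod ⟶ N) : LeftIdeal X where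
  carrier Y := ((f.hom.app Y).hom.range.comap (g.hom.app Y).hom).map (I.carrier Y).subtype
  comp_mem {Y Z h} k hh := by
    obtain ⟨h, ⟨x, hx⟩, rfl⟩ := hh
    refine ⟨(I.toMod.obj.map k).hom h, ⟨(M.obj.map k).hom x, ?_⟩, rfl⟩
    rw [naturality_apply, hx]
    exact (naturality_apply g k h).symm

theorem LeftIdeal.mem_comapRange {M N : ModCat C} {f : M ⟶ N} {X Y : C} {I : LeftIdeal X}
    {g : I.toMod ⟶ N} {h : X ⟶ Y} :
    h ∈ (LeftIdeal.comapRange f g).carrier Y ↔ ∃ (hh : h ∈ I.carrier Y) (x : M.obj.obj Y),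
      (f.hom.app Y).hom x = (g.hom.app Y).hom (show I.toMod.obj.obj Y from ⟨h, hh⟩) := by
  constructor
  · rintro ⟨h, ⟨x, hx⟩, rfl⟩
    exact ⟨h.2, x, hx⟩
  · rintro ⟨hh, x, hx⟩
    exact ⟨⟨h, hh⟩, ⟨x, hx⟩, rfl⟩

theorem exists_of_exact {S : ShortComplex (ModCat C)} (hS : S.Exact) (X : C)
    (x : S.X₂.obj.obj X) (hx : (S.g.hom.app X).hom x = 0) :
    ∃ y : S.X₁.obj.obj X, (S.f.hom.app X).hom y = x := by
  have : (AdditiveFunctor.forget C AddCommGrpCat.{v}).PreservesHomology :=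
    { preservesKernels := fun _ _ f =>
        (additiveFunctor C AddCommGrpCat.{v}).preservesKernels_ι f
      preservesCokernels := fun _ _ f =>
        (additiveFunctor C AddCommGrpCat.{v}).preservesCokernels_ι f }
  have h1 := (hS.map (AdditiveFunctor.forget C AddCommGrpCat.{v})).map
    ((evaluation C AddCommGrpCat.{v}).obj X)
  exact (ShortComplex.ab_exact_iff _).1 h1 x hx

theorem exists_kernel_ι_apply {M N : ModCat C} (f : M ⟶ N) {X : C} (x : M.obj.obj X)
    (hx : (f.hom.app X).hom x = 0) :
    ∃ k : (kernel f).obj.obj X, ((kernel.ι f).hom.app X).hom k = x :=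
  exists_of_exact ((ShortComplex.mk _ _ (kernel.condition f)).exact_of_f_is_kernel
    (kernelIsKernel f)) X x hx

theorem exists_of_cokernel_π_apply {M N : ModCat C} (f : M ⟶ N) {X : C} (y : N.obj.obj X)
    (hy : ((cokernel.π f).hom.app X).hom y = 0) :
    ∃ x : M.obj.obj X, (f.hom.app X).hom x = y :=
  exists_of_exact ((ShortComplex.mk _ _ (cokernel.condition f)).exact_of_g_is_cokernel
    (cokernelIsCokernel f)) X y hy

end Elements

/-! ### Torsion-free and closed modules; locality of closed modules -/

namespace LeftGabrielFilter

variable (F : LeftGabrielFilter C)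

/-- An element of the kernel has the same annihilator there as in `M`, and the annihilator of the
class of `y` in the cokernel is `rangeIdeal f y`. -/
theorem isoModSerre_iff_elements {M N : ModCat C} (f : M ⟶ N) :
    F.torsion.isoModSerre f ↔
      (∀ (X : C) (x : M.obj.obj X), (f.hom.app X).hom x = 0 → LeftIdeal.ann M x ∈ F.sets X) ∧
      (∀ (X : C) (y : N.obj.obj X), rangeIdeal f y ∈ F.sets X) := by
  constructor
  · rintro ⟨h1, h2⟩
    refine ⟨fun X x hx => ?_, fun X y => ?_⟩
    · obtain ⟨k, rfl⟩ := exists_kernel_ι_apply f x hx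
      exact F.mem_of_le (h1 X k) (ann_le_ann_app _ k)
    · refine F.mem_of_le (h2 X (((cokernel.π f).hom.app X).hom y)) fun Y h hh => ?_
      exact exists_of_cokernel_π_apply f _ ((naturality_apply _ h y).trans hh)
  · rintro ⟨h1, h2⟩
    refine ⟨fun X k => ?_, fun X c => ?_⟩
    · refine F.mem_of_le (h1 X (((kernel.ι f).hom.app X).hom k) ?_) (ann_app_le_ann _ k)
      rw [← comp_apply, kernel.condition]
      rfl
    · obtain ⟨y, rfl⟩ := app_surjective_of_epi (cokernel.π f) X c
      refine F.mem_of_le (h2 X y) fun Y h hh => ?_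
      obtain ⟨x, hx⟩ := hh
      have hx' : (f.hom.app Y).hom x = (N.obj.map h).hom y := hx
      rw [mem_ann, ← naturality_apply, ← hx', ← comp_apply, cokernel.condition]
      rfl

/-- A module is `F`-torsion-free if no non-zero element is annihilated by an ideal of `F`. -/
def torsionFree : ObjectProperty (ModCat C) :=
  fun M => ∀ (X : C) (x : M.obj.obj X), LeftIdeal.ann M x ∈ F.sets X → x = 0

variable {F}

/-- The hypothesis puts `I` inside the annihilator of `x - y`. This is the uniqueness principle
behind all later arguments. -/
theorem torsionFree.eq_of_forall {M : ModCat C} (hM : F.torsionFree M) {X : C}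
    {I : LeftIdeal X} (hI : I ∈ F.sets X) {x y : M.obj.obj X}
    (h : ∀ (Y : C) (f : X ⟶ Y), f ∈ I.carrier Y → (M.obj.map f).hom x = (M.obj.map f).hom y) :
    x = y := by
  refine sub_eq_zero.1 (hM X _ (F.mem_of_le hI fun Y f hf => ?_))
  rw [mem_ann, map_sub, h Y f hf, sub_self]

/-- The morphism `Hom(X, -) ⟶ M` given by `x` restricts to zero on `Ann(x, -)`, as the zero morphism
does. -/
theorem torsionFree_of_closed {M : ModCat C} (hM : F.closed M) : F.torsionFree M := by
  intro X x hx
  have h : ofElement M x = 0 := by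
    refine (hM X _ hx).1 (hom_ext_apply fun Y f => ?_)
    exact f.2
  have h' := congrArg (fun g => (g.hom.app X).hom (show (rep X).obj.obj X from 𝟙 X)) h
  exact (map_id_apply M x).symm.trans h'

theorem exists_of_closed {M : ModCat C} (hM : F.closed M) {X : C} {I : LeftIdeal X}
    (hI : I ∈ F.sets X) (φ : I.toMod ⟶ M) :
    ∃ x : M.obj.obj X, ∀ (Y : C) (f : X ⟶ Y) (hf : f ∈ I.carrier Y),
      (M.obj.map f).hom x = (φ.hom.app Y).hom (show I.toMod.obj.obj Y from ⟨f, hf⟩) := by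
  obtain ⟨g, hg⟩ := (hM X I hI).2 φ
  refine ⟨(g.hom.app X).hom (show (rep X).obj.obj X from 𝟙 X), fun Y f hf => ?_⟩
  rw [← rep_hom_apply]
  exact congrArg (fun g => (g.hom.app Y).hom (show I.toMod.obj.obj Y from ⟨f, hf⟩)) hg

/-- Torsion-freeness already makes restriction injective; by Yoneda, only extensions remain to be
found, as elements of `M(X)`. -/
theorem closed_of_torsionFree {M : ModCat C} (hM : F.torsionFree M)
    (h : ∀ (X : C) (I : LeftIdeal X), I ∈ F.sets X → ∀ φ : I.toMod ⟶ M,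
      ∃ x : M.obj.obj X, ∀ (Y : C) (f : X ⟶ Y) (hf : f ∈ I.carrier Y),
        (M.obj.map f).hom x = (φ.hom.app Y).hom (show I.toMod.obj.obj Y from ⟨f, hf⟩)) :
    F.closed M := by
  refine fun X I hI => ⟨fun g₁ g₂ hg => hom_ext_apply fun Y f => ?_, fun φ => ?_⟩
  · refine (rep_hom_apply g₁ f).trans (Eq.trans ?_ (rep_hom_apply g₂ f).symm)
    congr 1
    refine hM.eq_of_forall hI fun Z k hk => ?_
    refine (rep_hom_apply g₁ k).symm.trans (Eq.trans ?_ (rep_hom_apply g₂ k))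
    exact congrArg (fun g => (g.hom.app Z).hom (show I.toMod.obj.obj Z from ⟨k, hk⟩)) hg
  · obtain ⟨x, hx⟩ := h X I hI φ
    exact ⟨ofElement M x, hom_ext_apply fun Y f => hx Y f.1 f.2⟩

/-- Restriction along a morphism with torsion kernel and cokernel is bijective on morphisms to an
`F`-closed module. -/
theorem isoModSerre_le_isLocal_closed : F.torsion.isoModSerre ≤ F.closed.isLocal := by
  intro A B f hf N hN
  obtain ⟨hker, hcoker⟩ := (F.isoModSerre_iff_elements f).1 hf
  have hN' := torsionFree_of_closed hN
  constructor
  · intro g₁ g₂ hg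
    refine hom_ext_apply fun X b => hN'.eq_of_forall (hcoker X b) fun Y h hh => ?_
    obtain ⟨a, ha⟩ := mem_rangeIdeal.1 hh
    rw [← naturality_apply, ← naturality_apply, ← ha]
    exact congrArg (fun g => (g.hom.app Y).hom a) hg
  · intro u
    -- `a - a'` lies in the kernel of `f`, so its annihilator is in the filter, and it also kills
    -- `u(a) - u(a')`.
    have hwd : ∀ (Y : C) (a a' : A.obj.obj Y), (f.hom.app Y).hom a = (f.hom.app Y).hom a' →
        (u.hom.app Y).hom a = (u.hom.app Y).hom a' := by
      intro Y a a' h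
      refine hN'.eq_of_forall (hker Y (a - a') (by rw [map_sub, h, sub_self])) fun Z k hk => ?_
      have hk' := mem_ann.1 hk
      rw [map_sub, sub_eq_zero] at hk'
      rw [← naturality_apply, ← naturality_apply, hk']
    -- The displayed condition characterizes the value at `b` of an extension of `u`; additivity and
    -- naturality of the extension come from such uniqueness.
    have huniq : ∀ (X : C) (b : B.obj.obj X) (n n' : N.obj.obj X),
        (∀ (Y : C) (h : X ⟶ Y) (a : A.obj.obj Y), (f.hom.app Y).hom a = (B.obj.map h).hom b →
          (N.obj.map h).hom n = (u.hom.app Y).hom a) →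
        (∀ (Y : C) (h : X ⟶ Y) (a : A.obj.obj Y), (f.hom.app Y).hom a = (B.obj.map h).hom b →
          (N.obj.map h).hom n' = (u.hom.app Y).hom a) → n = n' := by
      intro X b n n' hn hn'
      refine hN'.eq_of_forall (hcoker X b) fun Y h hh => ?_
      obtain ⟨a, ha⟩ := mem_rangeIdeal.1 hh
      rw [hn Y h a ha, hn' Y h a ha]
    have hex : ∀ (X : C) (b : B.obj.obj X), ∃ n : N.obj.obj X,
        ∀ (Y : C) (h : X ⟶ Y) (a : A.obj.obj Y), (f.hom.app Y).hom a = (B.obj.map h).hom b →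
          (N.obj.map h).hom n = (u.hom.app Y).hom a := by
      intro X b
      -- Arbitrary preimages under `f`; `hwd` makes `u ∘ p` independent of the choice, hence a
      -- morphism on the ideal.
      choose p hp using fun (Y : C) (h : (rangeIdeal f b).toMod.obj.obj Y) =>
        mem_rangeIdeal.1 h.2
      let φ : (rangeIdeal f b).toMod ⟶ N :=
        homOfComponents (fun Y h => (u.hom.app Y).hom (p Y h))
          (fun Y h k => by
            rw [← map_add]
            refine hwd Y _ _ ?_
            rw [map_add, hp, hp, hp, ← map_add_apply]
            rfl)
          (fun Y Z k h => by
            rw [← naturality_apply]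
            refine hwd Z _ _ ?_
            rw [naturality_apply, hp, hp, ← map_comp_apply]
            rfl)
      obtain ⟨n, hn⟩ := exists_of_closed hN (hcoker X b) φ
      refine ⟨n, fun Y h a ha => (hn Y h ⟨a, ha⟩).trans (hwd Y _ _ ?_)⟩
      rw [hp, ha]
    choose g hg using hex
    refine ⟨homOfComponents g (fun X b c => ?_) (fun X Y k b => ?_),
      hom_ext_apply fun X a => ?_⟩
    · refine hN'.eq_of_forall (F.inter_mem (hcoker X b) (hcoker X c)) fun Y h hh => ?_
      obtain ⟨a, ha⟩ := mem_rangeIdeal.1 hh.1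
      obtain ⟨a', ha'⟩ := mem_rangeIdeal.1 hh.2
      rw [hg X (b + c) Y h (a + a') (by rw [map_add, map_add, ha, ha']), map_add, map_add,
        hg X b Y h a ha, hg X c Y h a' ha']
    · refine huniq Y _ _ _ (hg Y _) fun Z h a ha => ?_
      rw [← map_comp_apply] at ha ⊢
      exact hg X b Z _ a ha
    · change g X ((f.hom.app X).hom a) = _
      rw [← map_id_apply N (g X _)]
      exact hg X _ X (𝟙 X) a (map_id_apply B _).symm

end LeftGabrielFilter

/-! ### Small sets of representatives of objects -/

section Representatives

variable (C : Type u) [Category.{v} C] [EssentiallySmall.{v} C]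

/-- Representatives of the isomorphism classes of objects of `C`, indexed by a small type. -/
noncomputable abbrev reprObj (s : SmallModel.{v} C) : C := (equivSmallModel.{v} C).inverse.obj s

variable {C} in
theorem exists_iso_reprObj (Y : C) : ∃ s : SmallModel.{v} C, Nonempty (Y ≅ reprObj C s) :=
  ⟨_, ⟨(equivSmallModel.{v} C).unitIso.app Y⟩⟩

end Representatives

/-! ### The module `M⁺` and the closed module `M⁺⁺` -/

section Plus

variable [EssentiallySmall.{v} C]

variable (F : LeftGabrielFilter C) (M : ModCat C)

/-- A family of functions `Hom(X, Y) → M(Y)` is linear on a left ideal `I`. -/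
structure IsLinearOn {M : ModCat C} {X : C}
    (φ : ∀ s : SmallModel.{v} C, (X ⟶ reprObj C s) → M.obj.obj (reprObj C s)) (I : LeftIdeal X) :
    Prop where
  add : ∀ (s : SmallModel.{v} C) (f g : X ⟶ reprObj C s), f ∈ I.carrier _ → g ∈ I.carrier _ →
    φ s (f + g) = φ s f + φ s g
  map : ∀ (s t : SmallModel.{v} C) (f : X ⟶ reprObj C s) (k : reprObj C s ⟶ reprObj C t),
    f ∈ I.carrier _ → φ t (f ≫ k) = (M.obj.map k).hom (φ s f)

/-- The group of families of functions `Hom(X, Y) → M(Y)` that are linear on an ideal of `F`. -/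
def linearFamilies (X : C) :
    AddSubgroup (∀ s : SmallModel.{v} C, (X ⟶ reprObj C s) → M.obj.obj (reprObj C s)) where
  -- Families are total functions, so that they can be added although the ideals vary. Values off
  -- `I` are irrelevant modulo `nullFamilies`.
  carrier := {φ | ∃ I ∈ F.sets X, IsLinearOn φ I}
  zero_mem' := by
    obtain ⟨I, hI⟩ := F.nonempty X
    exact ⟨I, hI, fun _ _ _ _ _ => (add_zero _).symm, fun _ _ _ _ _ => (map_zero _).symm⟩
  add_mem' := by
    rintro φ ψ ⟨I, hI, hφ⟩ ⟨J, hJ, hψ⟩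
    refine ⟨_, F.inter_mem hI hJ, fun s f g hf hg => ?_, fun s t f k hf => ?_⟩
    · simp only [Pi.add_apply, hφ.add s f g hf.1 hg.1, hψ.add s f g hf.2 hg.2]
      abel
    · simp only [Pi.add_apply, hφ.map s t f k hf.1, hψ.map s t f k hf.2, map_add]
  neg_mem' := by
    rintro φ ⟨I, hI, hφ⟩
    refine ⟨I, hI, fun s f g hf hg => ?_, fun s t f k hf => ?_⟩
    · simp only [Pi.neg_apply, hφ.add s f g hf hg]
      abel
    · simp only [Pi.neg_apply, hφ.map s t f k hf, map_neg]

/-- The families that vanish on an ideal of `F`. -/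
def nullFamilies (X : C) : AddSubgroup (linearFamilies F M X) where
  carrier := {φ | ∃ I ∈ F.sets X, ∀ (s : SmallModel.{v} C) (f : X ⟶ reprObj C s),
    f ∈ I.carrier _ → φ.1 s f = 0}
  zero_mem' := by
    obtain ⟨I, hI⟩ := F.nonempty X
    exact ⟨I, hI, fun _ _ _ => rfl⟩
  add_mem' := by
    rintro φ ψ ⟨I, hI, hφ⟩ ⟨J, hJ, hψ⟩
    refine ⟨_, F.inter_mem hI hJ, fun s f hf => ?_⟩
    change φ.1 s f + ψ.1 s f = 0
    rw [hφ s f hf.1, hψ s f hf.2, add_zero]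
  neg_mem' := by
    rintro φ ⟨I, hI, hφ⟩
    refine ⟨I, hI, fun s f hf => ?_⟩
    change - φ.1 s f = 0
    rw [hφ s f hf, neg_zero]

/-- Precomposition of a family with `h : X ⟶ B`. -/
noncomputable def precompFamily {X B : C} (h : X ⟶ B) :
    linearFamilies F M X →+ linearFamilies F M B where
  toFun φ := ⟨fun s f => φ.1 s (h ≫ f), by
    obtain ⟨I, hI, hφ⟩ := φ.2
    refine ⟨_, F.colon_mem h hI, fun s f g hf hg => ?_, fun s t f k hf => ?_⟩
    · rw [Preadditive.comp_add]
      exact hφ.add s _ _ hf hg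
    · rw [← Category.assoc]
      exact hφ.map s t _ k hf⟩
  map_zero' := rfl
  map_add' _ _ := rfl

/-- Transition maps of the module of quotients. -/
noncomputable def plusMap {X B : C} (h : X ⟶ B) :
    linearFamilies F M X ⧸ nullFamilies F M X →+ linearFamilies F M B ⧸ nullFamilies F M B :=
  QuotientAddGroup.map _ _ (precompFamily F M h) (by
    rintro φ ⟨I, hI, hφ⟩
    exact ⟨_, F.colon_mem h hI, fun s f hf => hφ s _ hf⟩)

theorem plus_sound {F : LeftGabrielFilter C} {M : ModCat C} {X : C}
    {φ ψ : linearFamilies F M X} {I : LeftIdeal X} (hI : I ∈ F.sets X)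
    (h : ∀ (s : SmallModel.{v} C) (f : X ⟶ reprObj C s), f ∈ I.carrier _ → φ.1 s f = ψ.1 s f) :
    (φ : linearFamilies F M X ⧸ nullFamilies F M X) = ψ := by
  refine QuotientAddGroup.eq_iff_sub_mem.2 ⟨I, hI, fun s f hf => ?_⟩
  exact sub_eq_zero.2 (h s f hf)

theorem plusMap_id (X : C) : plusMap F M (𝟙 X) = AddMonoidHom.id _ := by
  refine DFunLike.ext _ _ fun x => ?_
  obtain ⟨φ, rfl⟩ := QuotientAddGroup.mk_surjective x
  obtain ⟨I, hI⟩ := F.nonempty X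
  exact plus_sound hI fun s f _ => congrArg (φ.1 s) (Category.id_comp f)

theorem plusMap_comp {X Y Z : C} (g : X ⟶ Y) (h : Y ⟶ Z) :
    plusMap F M (g ≫ h) = (plusMap F M h).comp (plusMap F M g) := by
  refine DFunLike.ext _ _ fun x => ?_
  obtain ⟨φ, rfl⟩ := QuotientAddGroup.mk_surjective x
  obtain ⟨I, hI⟩ := F.nonempty Z
  exact plus_sound hI fun s f _ => congrArg (φ.1 s) (Category.assoc g h f)

theorem plusMap_add {X Y : C} (g h : X ⟶ Y) :
    plusMap F M (g + h) = plusMap F M g + plusMap F M h := by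
  refine DFunLike.ext _ _ fun x => ?_
  obtain ⟨φ, rfl⟩ := QuotientAddGroup.mk_surjective x
  obtain ⟨I, hI, hφ⟩ := φ.2
  refine plus_sound (ψ := precompFamily F M g φ + precompFamily F M h φ)
    (F.inter_mem (F.colon_mem g hI) (F.colon_mem h hI)) fun s f hf => ?_
  exact (congrArg (φ.1 s) (Preadditive.add_comp _ _ _ g h f)).trans
    (hφ.add s _ _ hf.1 hf.2)

/-- The module `M⁺` with `M⁺(X) = colim Hom(I, M)`, where `I` runs through the ideals of `F` in
`Hom(X, -)`. -/
noncomputable def plus : ModCat C where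
  obj :=
    { obj := fun X => AddCommGrpCat.of (linearFamilies F M X ⧸ nullFamilies F M X)
      map := fun h => AddCommGrpCat.ofHom (plusMap F M h)
      map_id := fun X => AddCommGrpCat.hom_ext (plusMap_id F M X)
      map_comp := fun g h => AddCommGrpCat.hom_ext (plusMap_comp F M g h) }
  property :=
    { map_add := fun {_ _ g h} => AddCommGrpCat.hom_ext (plusMap_add F M g h) }

variable {M}

/-- The element of `M⁺(X)` represented by a family. -/
noncomputable def plusMk {X : C} (φ : linearFamilies F M X) : (plus F M).obj.obj X :=
  (φ : linearFamilies F M X ⧸ nullFamilies F M X)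

theorem exists_plusMk {X : C} (p : (plus F M).obj.obj X) : ∃ φ, plusMk F φ = p :=
  QuotientAddGroup.mk_surjective p

theorem plus_map_mk {X B : C} (h : X ⟶ B) (φ : linearFamilies F M X) :
    ((plus F M).obj.map h).hom (plusMk F φ) = plusMk F (precompFamily F M h φ) := rfl

theorem plusMk_eq_zero {X : C} {φ : linearFamilies F M X} :
    plusMk F φ = 0 ↔ ∃ I ∈ F.sets X, ∀ (s : SmallModel.{v} C) (f : X ⟶ reprObj C s),
      f ∈ I.carrier _ → φ.1 s f = 0 :=
  QuotientAddGroup.eq_zero_iff φ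

/-- The family that an element of `M(X)` defines. -/
noncomputable def elementFamily (X : C) : M.obj.obj X →+ linearFamilies F M X where
  toFun x := ⟨fun _ f => (M.obj.map f).hom x, by
    obtain ⟨I, hI⟩ := F.nonempty X
    exact ⟨I, hI, fun s f g _ _ => map_add_apply M f g x,
      fun s t f k _ => map_comp_apply M f k x⟩⟩
  map_zero' := by
    ext s f
    exact map_zero _
  map_add' x y := by
    ext s f
    exact map_add _ x y

variable (M) in
/-- The canonical morphism from `M` to `M⁺`. -/
noncomputable def toPlus : M ⟶ plus F M :=
  homOfComponents (fun X x => plusMk F (elementFamily F X x))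
    (fun X x y => by rw [map_add]; rfl)
    (fun X Y h x => by
      obtain ⟨I, hI⟩ := F.nonempty Y
      refine plus_sound hI fun s f _ => ?_
      exact (map_comp_apply M h f x).symm)

theorem toPlus_apply {X : C} (x : M.obj.obj X) :
    ((toPlus F M).hom.app X).hom x = plusMk F (elementFamily F X x) := rfl

variable {F}

/-- A filter ideal may be tested on the representatives. -/
theorem mem_of_le_reprObj {X : C} {I J : LeftIdeal X} (hI : I ∈ F.sets X)
    (h : ∀ (s : SmallModel.{v} C) (f : X ⟶ reprObj C s), f ∈ I.carrier _ → f ∈ J.carrier _) :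
    J ∈ F.sets X := by
  refine F.mem_of_le hI fun Y f hf => ?_
  obtain ⟨s, ⟨a⟩⟩ := exists_iso_reprObj Y
  have := J.comp_mem a.inv (h s _ (I.comp_mem a.hom hf))
  rwa [Category.assoc, a.hom_inv_id, Category.comp_id] at this

theorem ann_mem_of_toPlus_eq_zero {X : C} {x : M.obj.obj X}
    (hx : ((toPlus F M).hom.app X).hom x = 0) : LeftIdeal.ann M x ∈ F.sets X := by
  obtain ⟨I, hI, h⟩ := (plusMk_eq_zero F).1 hx
  exact mem_of_le_reprObj hI h

/-- Linearity says `φ(f ≫ k) = M(k)(φ(f))`, which is the family of the element `φ(f)`. Thus `I`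
carries the class of `φ` into the image of `M`. -/
theorem plus_map_mk_eq {X : C} {φ : linearFamilies F M X} {I : LeftIdeal X}
    (hφ : IsLinearOn φ.1 I) (s : SmallModel.{v} C) (f : X ⟶ reprObj C s) (hf : f ∈ I.carrier _) :
    ((plus F M).obj.map f).hom (plusMk F φ) =
      ((toPlus F M).hom.app (reprObj C s)).hom (φ.1 s f) := by
  rw [plus_map_mk, toPlus_apply]
  obtain ⟨J, hJ⟩ := F.nonempty (reprObj C s)
  exact plus_sound hJ fun t k _ => hφ.map s t f k hf

variable (F M) in
theorem isoModSerre_toPlus : F.torsion.isoModSerre (toPlus F M) := by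
  refine (F.isoModSerre_iff_elements _).2
    ⟨fun X x hx => ann_mem_of_toPlus_eq_zero hx, fun X p => ?_⟩
  obtain ⟨φ, rfl⟩ := exists_plusMk F p
  obtain ⟨I, hI, hφ⟩ := φ.2
  exact mem_of_le_reprObj hI fun s f hf => ⟨φ.1 s f, (plus_map_mk_eq hφ s f hf).symm⟩

/-- The left ideal of the elements of `I` on which a family that is linear on `I` vanishes. -/
def vanishingIdeal {X : C}
    {φ : ∀ s : SmallModel.{v} C, (X ⟶ reprObj C s) → M.obj.obj (reprObj C s)} {I : LeftIdeal X}
    (hφ : IsLinearOn φ I) : LeftIdeal X where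
  carrier Y :=
    -- `φ` takes values only at representatives, so vanishing at `f : X ⟶ Y` is tested after every
    -- morphism from `Y` to a representative.
    { carrier := {f | f ∈ I.carrier Y ∧
        ∀ (s : SmallModel.{v} C) (k : Y ⟶ reprObj C s), φ s (f ≫ k) = 0}
      add_mem' := fun {f g} hf hg => ⟨(I.carrier Y).add_mem hf.1 hg.1, fun s k => by
        rw [Preadditive.add_comp, hφ.add s _ _ (I.comp_mem k hf.1) (I.comp_mem k hg.1),
          hf.2, hg.2, add_zero]⟩
      zero_mem' := ⟨(I.carrier Y).zero_mem, fun s k => by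
        have h := hφ.add s 0 0 (I.carrier _).zero_mem (I.carrier _).zero_mem
        rw [add_zero, left_eq_add] at h
        rw [zero_comp, h]⟩
      neg_mem' := fun {f} hf => ⟨(I.carrier Y).neg_mem hf.1, fun s k => by
        have hk := I.comp_mem k hf.1
        have h := hφ.add s (f ≫ k) 0 hk (I.carrier _).zero_mem
        rw [add_zero, left_eq_add] at h
        have h' := hφ.add s (f ≫ k) (-(f ≫ k)) hk ((I.carrier _).neg_mem hk)
        rw [add_neg_cancel, h, hf.2, zero_add] at h'
        rw [Preadditive.neg_comp, ← h']⟩ }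
  comp_mem {Y Z f} g hf := ⟨I.comp_mem g hf.1, fun s k => by
    rw [Category.assoc]
    exact hf.2 s _⟩

variable (F M) in
-- Let `φ` be linear on `I` and represent `p`, with `Ann(p, -)` in the filter. For `h` in `I ∩
-- Ann(p, -)`, the element `φ(h)` dies in `M⁺`, so its annihilator is in the filter; it lies in `(K
-- : h)`, where `K` is the vanishing ideal of `φ`. By T4, `K` is in the filter, so `p = 0`.
theorem torsionFree_plus : F.torsionFree (plus F M) := by
  intro X p hp
  obtain ⟨φ, rfl⟩ := exists_plusMk F p
  obtain ⟨I, hI, hφ⟩ := φ.2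
  have hK : vanishingIdeal hφ ∈ F.sets X := by
    refine F.mem_of_colon_mem (F.inter_mem hI hp) fun B h hh => ?_
    -- `φ(h)` makes sense only if `B` is a representative; in general `h ≫ a.hom` replaces `h`.
    obtain ⟨s, ⟨a⟩⟩ := exists_iso_reprObj B
    have hI' : h ≫ a.hom ∈ I.carrier _ := I.comp_mem a.hom hh.1
    have hann : LeftIdeal.ann M (φ.1 s (h ≫ a.hom)) ∈ F.sets _ :=
      ann_mem_of_toPlus_eq_zero ((plus_map_mk_eq hφ s _ hI').symm.trans
        ((LeftIdeal.ann _ (plusMk F φ)).comp_mem a.hom hh.2))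
    refine F.mem_of_le (F.colon_mem a.inv hann) fun Z g hg => ?_
    refine ⟨I.comp_mem g hh.1, fun t k => ?_⟩
    have e : (h ≫ g) ≫ k = (h ≫ a.hom) ≫ (a.inv ≫ g) ≫ k := by simp
    have hg' : (M.obj.map (a.inv ≫ g)).hom (φ.1 s (h ≫ a.hom)) = 0 := hg
    rw [e, hφ.map s t _ _ hI', map_comp_apply, hg', map_zero]
  refine (plusMk_eq_zero F).2 ⟨_, hK, fun s f hf => ?_⟩
  have := hf.2 s (𝟙 _)
  rwa [Category.comp_id] at this

theorem toPlus_injective (hM : F.torsionFree M) {X : C} :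
    Function.Injective ((toPlus F M).hom.app X).hom :=
  (injective_iff_map_eq_zero _).2 fun _ hx => hM X _ (ann_mem_of_toPlus_eq_zero hx)

/-- Given `g : I ⟶ M⁺`, let `J ⊆ I` be the part that `g` sends into the image of `M`. As `M ⟶ M⁺`
has torsion cokernel, T4 puts `J` in the filter. As `M ⟶ M⁺` is injective, `g` lifts on `J` to a
linear family, whose class is the required element. -/
theorem closed_plus (hM : F.torsionFree M) : F.closed (plus F M) := by
  refine F.closed_of_torsionFree (torsionFree_plus F M) fun X I hI g => ?_
  let J : LeftIdeal X := LeftIdeal.comapRange (toPlus F M) g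
  have hJ : J ∈ F.sets X := by
    refine F.mem_of_colon_mem hI fun B h hh => ?_
    have hW := ((F.isoModSerre_iff_elements _).1 (isoModSerre_toPlus F M)).2 B
      ((g.hom.app B).hom (show I.toMod.obj.obj B from ⟨h, hh⟩))
    refine F.mem_of_le hW fun Y k hk => LeftIdeal.mem_comapRange.2 ?_
    obtain ⟨x, hx⟩ := mem_rangeIdeal.1 hk
    exact ⟨I.comp_mem k hh, x, hx.trans (naturality_apply g k _).symm⟩
  choose hJI ψ hψ using fun (Y : C) (f : J.carrier Y) => LeftIdeal.mem_comapRange.1 f.2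
  classical
  let φ : ∀ s : SmallModel.{v} C, (X ⟶ reprObj C s) → M.obj.obj (reprObj C s) :=
    -- The value 0 off `J` is a dummy: linearity is needed only on `J`.
    fun s f => if hf : f ∈ J.carrier _ then ψ _ ⟨f, hf⟩ else 0
  have hφ : ∀ (s : SmallModel.{v} C) (f : X ⟶ reprObj C s) (hf : f ∈ J.carrier _),
      ((toPlus F M).hom.app _).hom (φ s f) =
        (g.hom.app _).hom (show I.toMod.obj.obj _ from ⟨f, hJI _ ⟨f, hf⟩⟩) := by
    intro s f hf
    simp only [φ, dif_pos hf]
    exact hψ _ _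
  have hlin : IsLinearOn φ J := by
    refine ⟨fun s f k hf hk => toPlus_injective hM ?_, fun s t f k hf => toPlus_injective hM ?_⟩
    · rw [map_add, hφ s f hf, hφ s k hk, hφ s _ ((J.carrier _).add_mem hf hk), ← map_add]
      rfl
    · rw [naturality_apply, hφ s f hf, hφ t _ (J.comp_mem k hf), ← naturality_apply]
      rfl
  let p : (plus F M).obj.obj X := plusMk F ⟨φ, J, hJ, hlin⟩
  -- By construction `p` induces `g` only on `J`. For `f ∈ I` the difference of the two values is
  -- killed by `(J : f)`, hence zero because `M⁺` is torsion-free.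
  refine ⟨p, fun Y f hf => sub_eq_zero.1 (torsionFree_plus F M Y _
    (mem_of_le_reprObj (F.colon_mem f hJ) fun s k hk => ?_))⟩
  rw [mem_ann, map_sub, sub_eq_zero, ← map_comp_apply, ← naturality_apply]
  exact (plus_map_mk_eq (φ := ⟨φ, J, hJ, hlin⟩) hlin s _ hk).trans (hφ s _ hk)

variable (F M) in
theorem exists_isoModSerre_closed :
    ∃ (N : ModCat C) (f : M ⟶ N), F.closed N ∧ F.torsion.isoModSerre f :=
  ⟨_, toPlus F M ≫ toPlus F (plus F M), closed_plus (torsionFree_plus F M),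
    F.torsion.isoModSerre.comp_mem _ _ (isoModSerre_toPlus F M) (isoModSerre_toPlus F _)⟩

end Plus

/-! ### The reflector and the comparison with the Gabriel quotient -/

theorem isZero_of_fullyFaithful {D E : Type*} [Category* D] [Category* E] (F : D ⥤ E) [F.Full]
    [F.Faithful] {X : D} (h : IsZero (F.obj X)) : IsZero X where
  unique_to _ := ⟨⟨⟨F.preimage (h.to_ _)⟩, fun _ => F.map_injective (h.eq_of_src _ _)⟩⟩
  unique_from _ := ⟨⟨⟨F.preimage (h.from_ _)⟩, fun _ => F.map_injective (h.eq_of_tgt _ _)⟩⟩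

namespace LeftGabrielFilter

variable {F : LeftGabrielFilter C}

/-- If every module maps to an `F`-closed module by a morphism with torsion kernel and cokernel,
then the `F`-closed modules are a reflective subcategory. -/
theorem exists_adjunction_of_isoModSerre
    (h : ∀ M : ModCat C, ∃ (N : ModCat C) (f : M ⟶ N), F.closed N ∧ F.torsion.isoModSerre f) :
    ∃ (G : ModCat C ⥤ F.ClosedModCat) (adj : G ⊣ F.inclusion),
      ∀ M, F.torsion.isoModSerre (adj.unit.app M) := by
  choose N f hN hf using h
  let G : ModCat C ⥤ F.ClosedModCat := Adjunction.leftAdjointOfEquiv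
    (G := F.inclusion) (F_obj := fun M => ⟨N M, hN M⟩)
    (fun M P => (F.closed.fullyFaithfulι.homEquiv (X := ⟨N M, hN M⟩) (Y := P)).trans
      (Equiv.ofBijective _ (isoModSerre_le_isLocal_closed _ (hf M) P.obj P.property)))
    (fun M P P' g k => (Category.assoc (f M) k.hom g.hom).symm)
  let adj : G ⊣ F.inclusion := Adjunction.adjunctionOfEquivLeft _ _
  refine ⟨G, adj, fun M => ?_⟩
  -- The unit corresponds to the identity of `G M` under the Hom-bijection, which is precomposition
  -- with `f M`.
  have : adj.unit.app M = f M := by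
    simp only [adj]
    exact Category.comp_id (f M)
  rw [this]
  exact hf M

/-- A reflector inverts exactly the morphisms local for the closed modules. If `G` inverts `f`, then
`f` followed by the unit at `B` is the unit at `A` followed by an isomorphism, and two-out-of-three
applies. -/
theorem isoModSerre_eq_inverseImage_isomorphisms {G : ModCat C ⥤ F.ClosedModCat} (adj : G ⊣ F.inclusion)
    (h : ∀ M, F.torsion.isoModSerre (adj.unit.app M)) :
    F.torsion.isoModSerre = (MorphismProperty.isomorphisms _).inverseImage G := by
  ext A B f
  rw [← ObjectProperty.isLocal_eq_inverseImage_isomorphisms adj]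
  constructor
  · rintro hf _ ⟨P, rfl⟩
    exact isoModSerre_le_isLocal_closed f hf P.obj P.property
  · intro hf
    rw [ObjectProperty.isLocal_iff_isIso_map adj] at hf
    refine F.torsion.isoModSerre.of_postcomp f (adj.unit.app B) (h B) ?_
    have hn : f ≫ adj.unit.app B = adj.unit.app A ≫ F.inclusion.map (G.map f) :=
      adj.unit.naturality f
    rw [hn]
    exact F.torsion.isoModSerre.comp_mem _ _ (h A) (F.torsion.isoModSerre_of_isIso _)

/-- A reflector onto the `F`-closed modules whose unit has torsion kernels and cokernels is exact,
and identifies the `F`-closed modules with the Gabriel quotient. -/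
theorem exists_equivalence_of_adjunction {G : ModCat C ⥤ F.ClosedModCat} (adj : G ⊣ F.inclusion)
    (h : ∀ M, F.torsion.isoModSerre (adj.unit.app M)) :
    ∃ (e : F.ClosedModCat ≌ F.GabrielQuotient),
      PreservesFiniteLimits G ∧ PreservesFiniteColimits G ∧
      (∀ M : ModCat C, IsZero (G.obj M) ↔ F.torsion M) ∧
      Nonempty (e.functor ≅ F.inclusion ⋙ F.quotientFunctor) ∧
      Nonempty (G ⋙ e.functor ≅ F.quotientFunctor) := by
  have : G.IsLocalization F.torsion.isoModSerre := by
    rw [isoModSerre_eq_inverseImage_isomorphisms adj h]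
    exact adj.isLocalization
  let e : F.ClosedModCat ≌ F.GabrielQuotient :=
    Localization.uniq G F.quotientFunctor F.torsion.isoModSerre
  let i : G ⋙ e.functor ≅ F.quotientFunctor :=
    Localization.compUniqFunctor G F.quotientFunctor F.torsion.isoModSerre
  let j : F.quotientFunctor ⋙ e.inverse ≅ G :=
    Localization.compUniqInverse G F.quotientFunctor F.torsion.isoModSerre
  have := ObjectProperty.SerreClassLocalization.preservesFiniteLimits
    F.quotientFunctor F.torsion
  have := ObjectProperty.SerreClassLocalization.preservesFiniteColimits
    F.quotientFunctor F.torsion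
  refine ⟨e, preservesFiniteLimits_of_natIso j, preservesFiniteColimits_of_natIso j,
    fun M => ?_, ⟨?_⟩, ⟨i⟩⟩
  -- `Q M` is zero exactly for torsion `M`, and `Q M ≅ e (G M)`.
  · rw [← ObjectProperty.SerreClassLocalization.isZero_obj_iff F.quotientFunctor F.torsion,
      ← (i.app M).isZero_iff]
    exact ⟨fun hz => isZero_of_fullyFaithful e.inverse
      ((e.unitIso.app _).isZero_iff.1 hz), isZero_of_fullyFaithful e.functor⟩
  -- The counit is invertible because the inclusion is fully faithful, so `e ≅ e ∘ G ∘ i ≅ Q ∘ i`.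
  · exact e.functor.leftUnitor.symm ≪≫
      Functor.isoWhiskerRight (asIso adj.counit).symm e.functor ≪≫
      Functor.associator _ _ _ ≪≫ Functor.isoWhiskerLeft F.inclusion i

end LeftGabrielFilter

end GabrielLocalization

theorem mainTheorem4 {C : Type u} [Category.{v} C] [Preadditive C] [EssentiallySmall.{v} C]
    (F : GabrielLocalization.LeftGabrielFilter C) :
    ∃ (G : GabrielLocalization.ModCat C ⥤ F.ClosedModCat) (_ : G ⊣ F.inclusion)
      (e : F.ClosedModCat ≌ F.GabrielQuotient),
      PreservesFiniteLimits G ∧ PreservesFiniteColimits G ∧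
      (∀ M : GabrielLocalization.ModCat C, IsZero (G.obj M) ↔ F.torsion M) ∧
      Nonempty (e.functor ≅ F.inclusion ⋙ F.quotientFunctor) ∧
      Nonempty (G ⋙ e.functor ≅ F.quotientFunctor) := by
  obtain ⟨G, adj, h⟩ :=
    GabrielLocalization.LeftGabrielFilter.exists_adjunction_of_isoModSerre
      (GabrielLocalization.exists_isoModSerre_closed F)
  exact ⟨G, adj, GabrielLocalization.LeftGabrielFilter.exists_equivalence_of_adjunction adj h⟩
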